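/- Let $n\ge 3$ and let $C_n$ be the cycle on $n$ vertices. For a finite simple graph $G$ with vertex set $V$ let $\mathbf X_G=\sum_\kappa\prod_{v\in V}x_{\kappa(v)}$ be its chromatic symmetric function over $\mathbb Q$, the sum being over all proper colorings $\kappa$ of $G$ with colors in $\mathbb N$. For $k\ge 1$ let $\mathfrak{st}_k$ be the chromatic symmetric function of the star graph on $k$ vertices, and for a partition $\lambda=(\lambda_1,\dots,\lambda_\ell)\vdash n$ of length $\ell(\lambda)=\ell$ put $\mathfrak{st}_\lambda=\mathfrak{st}_{\lambda_1}\cdots\mathfrak{st}_{\lambda_\ell}$. Then there are unique rational numbers $c_\lambda$ ($\lambda\vdash n$) with $$\mathbf X_{C_n}=\sum_{\lambda\vdash n}c_\lambda\,\mathfrak{st}_\lambda .$$ They are as follows, where $m_i$ denotes the number of parts of $\lambda$ equal to $i$, so $\lambda=(1^{m_1}2^{m_2}\cdots n^{m_n})$. 1. If $\lambda=(n-m_1,1^{m_1})$ with $m_1\ne n-1$ (a hook partition other than $(1^n)$, including $\lambda=(n)$), then $$c_\lambda=(-1)^{m_1}\left[-\binom{n-2}{m_1-1}+(n-1)\binom{n-2}{m_1}\right],$$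 where $\binom{n-2}{-1}=0$. 2. If $\lambda=(1^n)$, then $c_\lambda=0$. 3. For every other partition $\lambda\vdash n$, $$c_\lambda=(-1)^{m_1}\,\frac{n}{\ell(\lambda)-m_1}\binom{m_2+\cdots+m_n}{m_2,\dots,m_n}\binom{n-\ell(\lambda)+m_1-1}{m_1}.$$ -/

import Mathlib

open scoped BigOperators

/-- The monomial `∏ v, x_{κ v}` of a colouring `κ : V → ℕ`, given by its exponent vector. -/
noncomputable def coloringExponent {V : Type*} [Fintype V] (κ : V → ℕ) : ℕ →₀ ℕ :=
  ∑ v, Finsupp.single (κ v) 1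

/-- The proper colourings of `G` by natural numbers whose monomial has exponent vector `d`. -/
def properColoringsOf {V : Type*} [Fintype V] (G : SimpleGraph V) (d : ℕ →₀ ℕ) : Set (V → ℕ) :=
  {κ | (∀ u v, G.Adj u v → κ u ≠ κ v) ∧ coloringExponent κ = d}

/-- Only finitely many proper colourings have a given monomial, so that counting them below
involves no default value. -/
theorem properColoringsOf_finite {V : Type*} [Fintype V] (G : SimpleGraph V) (d : ℕ →₀ ℕ) :
    (properColoringsOf G d).Finite := by
  refine (Set.Finite.pi' (t := fun _ : V => (d.support : Set ℕ))
    (fun _ => d.support.finite_toSet)).subset ?_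
  rintro κ ⟨-, rfl⟩ v
  have h : 1 ≤ coloringExponent κ (κ v) := by
    unfold coloringExponent
    rw [Finsupp.finsetSum_apply]
    calc 1 = Finsupp.single (κ v) 1 (κ v) := by simp
      _ ≤ _ := Finset.single_le_sum (f := fun u => Finsupp.single (κ u) 1 (κ v))
          (fun _ _ => Nat.zero_le _) (Finset.mem_univ v)
  simp only [Finset.mem_coe, Finsupp.mem_support_iff]
  omega

/-- The chromatic symmetric function `X_G = ∑_κ ∏_v x_{κ(v)}`, the sum being over all proper
colourings `κ : V → ℕ`, as a formal power series in the variables `x_i`, `i : ℕ`: the coefficient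
of a monomial is the number of proper colourings that contribute it. -/
noncomputable def chromaticSymmetricFunction {V : Type*} [Fintype V] (G : SimpleGraph V) :
    MvPowerSeries ℕ ℚ :=
  fun d => ((properColoringsOf G d).ncard : ℚ)

/-- The chromatic symmetric function of the star graph on `k` vertices
(for `k = 0`, which is not a part of any partition, that of the empty graph). -/
noncomputable def starFunction : ℕ → MvPowerSeries ℕ ℚ
  | 0 => 1
  | k + 1 => chromaticSymmetricFunction (SimpleGraph.starGraph (0 : Fin (k + 1)))

/-- `𝔰𝔱_p = ∏_i 𝔰𝔱_{p_i}`, the product being over the parts of the partition `p`. -/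
noncomputable def starBasis {n : ℕ} (p : n.Partition) : MvPowerSeries ℕ ℚ :=
  (p.parts.map starFunction).prod

/-- The number `m_i` of parts of `p` that are equal to `i`. -/
def partMult {n : ℕ} (p : n.Partition) (i : ℕ) : ℕ := p.parts.count i

/-- The length `ℓ(p)`: the number of parts of `p`. -/
def partLength {n : ℕ} (p : n.Partition) : ℕ := p.parts.card

/-- `p = (n - m₁, 1^{m₁})` with `m₁ ≠ n - 1`, where `m₁` is the number of parts of `p` equal to
one: the hook partitions other than `(1^n)`. -/
def IsProperHook {n : ℕ} (p : n.Partition) : Prop :=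
  p.parts = (n - partMult p 1) ::ₘ Multiset.replicate (partMult p 1) 1 ∧ partMult p 1 ≠ n - 1

instance {n : ℕ} (p : n.Partition) : Decidable (IsProperHook p) :=
  inferInstanceAs (Decidable (_ ∧ _))

/-- The binomial coefficient `C(a, b - 1)`, which is zero for `b = 0`. -/
def choosePred (a b : ℕ) : ℕ := if b = 0 then 0 else a.choose (b - 1)

section FiniteVariables

open Finset

open Classical in
/-- The set of proper colourings with colours in a finite type. -/
noncomputable def properColoringFinset {V ι : Type*} [Fintype V] [Fintype ι] (G : SimpleGraph V) :
    Finset (V → ι) :=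
  univ.filter fun κ => ∀ u v, G.Adj u v → κ u ≠ κ v

theorem mem_properColoringFinset {V ι : Type*} [Fintype V] [Fintype ι] (G : SimpleGraph V)
    (κ : V → ι) : κ ∈ properColoringFinset G ↔ ∀ u v, G.Adj u v → κ u ≠ κ v := by
  classical
  simp [properColoringFinset]

/-- The chromatic symmetric function evaluated at finitely many variables. -/
noncomputable def chromaticEval {V ι R : Type*} [Fintype V] [Fintype ι] [CommRing R]
    (G : SimpleGraph V) (x : ι → R) : R :=
  ∑ κ ∈ properColoringFinset G, ∏ v, x (κ v)

theorem embDomain_sum_single {V : Type*} [Fintype V] {N : ℕ} (κ : V → Fin N) :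
    Finsupp.embDomain Fin.valEmbedding (∑ v, Finsupp.single (κ v) 1) =
      coloringExponent fun v => (κ v : ℕ) := by
  rw [Finsupp.embDomain_eq_mapDomain, Finsupp.mapDomain_finsetSum]
  simp [coloringExponent, Finsupp.mapDomain_single]

theorem mem_support_coloringExponent {V : Type*} [Fintype V] (κ : V → ℕ) (v : V) :
    κ v ∈ (coloringExponent κ).support := by
  have h : Finsupp.single (κ v) 1 (κ v) ≤ ∑ u, Finsupp.single (κ u) 1 (κ v) :=
    single_le_sum (f := fun u => Finsupp.single (κ u) 1 (κ v))
      (fun _ _ => Nat.zero_le _) (mem_univ v)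
  rw [Finsupp.mem_support_iff, coloringExponent, Finsupp.finsetSum_apply]
  simp only [Finsupp.single_eq_same] at h
  omega

theorem killCompl_chromaticSymmetricFunction {V : Type*} [Fintype V] (G : SimpleGraph V) (N : ℕ) :
    MvPowerSeries.killCompl (R := ℚ) (Fin.valEmbedding (n := N)) (chromaticSymmetricFunction G) =
      ((chromaticEval G MvPolynomial.X : MvPolynomial (Fin N) ℚ) :
        MvPowerSeries (Fin N) ℚ) := by
  classical
  ext d
  rw [MvPowerSeries.coeff_killCompl, MvPolynomial.coeff_coe, chromaticEval,
    MvPolynomial.coeff_sum]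
  have h : ∀ κ : V → Fin N, MvPolynomial.coeff d (∏ v, (MvPolynomial.X (κ v) :
      MvPolynomial (Fin N) ℚ)) = if (∑ v, Finsupp.single (κ v) 1) = d then 1 else 0 := by
    intro κ
    have h1 : ∏ v, (MvPolynomial.X (κ v) : MvPolynomial (Fin N) ℚ) =
        MvPolynomial.monomial (∑ v, Finsupp.single (κ v) 1) 1 := by
      rw [MvPolynomial.monomial_sum_one]
      rfl
    rw [h1, MvPolynomial.coeff_monomial]
  simp only [h]
  rw [← sum_filter, sum_const, nsmul_one]
  change (((properColoringsOf G _).ncard : ℕ) : ℚ) = _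
  congr 1
  rw [← Set.ncard_coe_finset]
  symm
  refine Set.ncard_congr (fun κ _ v => (κ v : ℕ)) ?_ ?_ ?_
  · intro κ hκ
    rw [mem_coe, mem_filter, mem_properColoringFinset] at hκ
    refine ⟨fun u v huv h => hκ.1 u v huv (Fin.ext h), ?_⟩
    rw [← embDomain_sum_single, hκ.2]
  · intro κ κ' _ _ h
    funext v
    exact Fin.ext (congrFun h v)
  · rintro κ ⟨hκ, hd⟩
    have hlt : ∀ v, κ v < N := by
      intro v
      have := mem_support_coloringExponent κ v
      rw [hd, Finsupp.support_embDomain, mem_map] at this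
      obtain ⟨a, -, ha⟩ := this
      rw [← ha]
      exact a.2
    refine ⟨fun v => ⟨κ v, hlt v⟩, ?_, rfl⟩
    rw [mem_coe, mem_filter, mem_properColoringFinset]
    refine ⟨fun u v huv h => hκ u v huv (congrArg Fin.val h), ?_⟩
    apply Finsupp.embDomain_injective Fin.valEmbedding
    rw [embDomain_sum_single, ← hd]

theorem eq_of_forall_killCompl_eq {f g : MvPowerSeries ℕ ℚ}
    (h : ∀ N, MvPowerSeries.killCompl (R := ℚ) (Fin.valEmbedding (n := N)) f =
      MvPowerSeries.killCompl (Fin.valEmbedding (n := N)) g) : f = g := by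
  classical
  ext d
  have hd : ∃ N, ∃ e : Fin N →₀ ℕ, Finsupp.embDomain Fin.valEmbedding e = d := by
    refine ⟨d.support.sup id + 1, ?_⟩
    have : d ∈ Set.range (Finsupp.embDomain
        (Fin.valEmbedding (n := d.support.sup id + 1)) : _ → ℕ →₀ ℕ) := by
      rw [Finsupp.mem_range_embDomain_iff]
      intro a ha
      exact ⟨⟨a, Nat.lt_succ_of_le (le_sup (f := id) ha)⟩, rfl⟩
    exact this
  obtain ⟨N, e, rfl⟩ := hd
  rw [← MvPowerSeries.coeff_killCompl, h, MvPowerSeries.coeff_killCompl]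

/-- The chromatic symmetric function of the star on `k` vertices in finitely many variables. -/
def starEval {ι R : Type*} [Fintype ι] [CommRing R] (x : ι → R) (k : ℕ) : R :=
  ∑ c, x c * (∑ a, x a - x c) ^ (k - 1)

theorem chromaticEval_starGraph {ι R : Type*} [Fintype ι] [CommRing R] (x : ι → R) (k : ℕ) :
    chromaticEval (SimpleGraph.starGraph (0 : Fin (k + 1))) x = starEval x (k + 1) := by
  classical
  have hmem : ∀ κ : Fin (k + 1) → ι, κ ∈ properColoringFinset
      (SimpleGraph.starGraph (0 : Fin (k + 1))) ↔ ∀ v : Fin k, κ v.succ ≠ κ 0 := by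
    intro κ
    rw [mem_properColoringFinset]
    constructor
    · intro h v
      exact h _ _ (by simp)
    · intro h u v huv
      rw [SimpleGraph.starGraph_adj] at huv
      obtain ⟨hne, rfl | rfl⟩ := huv
      · obtain ⟨w, rfl⟩ := Fin.exists_succ_eq.2 hne.symm
        exact (h w).symm
      · obtain ⟨w, rfl⟩ := Fin.exists_succ_eq.2 hne
        exact h w
  have hfil : properColoringFinset (SimpleGraph.starGraph (0 : Fin (k + 1))) =
      univ.filter fun κ : Fin (k + 1) → ι => ∀ v : Fin k, κ v.succ ≠ κ 0 := by
    ext κ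
    rw [hmem, mem_filter]
    simp
  rw [chromaticEval, hfil, sum_filter, ← (Fin.consEquiv fun _ => ι).sum_comp,
    Fintype.sum_prod_type, starEval]
  refine sum_congr rfl fun c _ => ?_
  have hsub : ∑ a, x a - x c = ∑ a, if a ≠ c then x a else 0 := by
    rw [← sum_filter, filter_ne', ← sum_erase_add _ _ (mem_univ c)]
    ring
  rw [hsub, Nat.add_sub_cancel, Fintype.sum_pow, mul_sum]
  refine sum_congr rfl fun κ _ => ?_
  simp only [Fin.consEquiv_apply, Fin.cons_succ, Fin.cons_zero, Fin.prod_univ_succ]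
  rw [prod_ite_zero]
  simp

/-- The weighted adjacency matrix of the complete graph. -/
def offDiagonal {ι R : Type*} [DecidableEq ι] [CommRing R] (x : ι → R) : Matrix ι ι R :=
  fun i j => if i ≠ j then x i else 0

theorem sum_walk_eq_pow {ι R : Type*} [Fintype ι] [DecidableEq ι] [CommRing R]
    (B : Matrix ι ι R) (m : ℕ) (h : ι → ι → R) :
    ∑ κ : Fin (m + 1) → ι, (∏ k : Fin m, B (κ k.castSucc) (κ k.succ)) * h (κ 0) (κ (Fin.last m)) =
      ∑ i, ∑ j, (B ^ m) i j * h i j := by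
  induction m generalizing h with
  | zero =>
    rw [← (Fin.consEquiv fun _ => ι).sum_comp, Fintype.sum_prod_type]
    simp [Matrix.one_apply]
  | succ m ih =>
    rw [← (Fin.consEquiv fun _ => ι).sum_comp, Fintype.sum_prod_type]
    have h1 : ∀ (a : ι) (κ : Fin (m + 1) → ι),
        (∏ k : Fin (m + 1), B ((Fin.consEquiv fun _ => ι) (a, κ) k.castSucc)
          ((Fin.consEquiv fun _ => ι) (a, κ) k.succ)) *
            h ((Fin.consEquiv fun _ => ι) (a, κ) 0)
              ((Fin.consEquiv fun _ => ι) (a, κ) (Fin.last (m + 1))) =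
          (∏ k : Fin m, B (κ k.castSucc) (κ k.succ)) * (B a (κ 0) * h a (κ (Fin.last m))) := by
      intro a κ
      rw [Fin.prod_univ_succ]
      simp only [Fin.consEquiv_apply, Fin.cons_succ, Fin.cons_zero, ← Fin.succ_last,
        Fin.castSucc_zero, ← Fin.succ_castSucc]
      ring
    simp only [h1]
    rw [sum_congr rfl fun a _ => ih fun i j => B a i * h a j]
    refine sum_congr rfl fun a _ => ?_
    rw [sum_comm]
    refine sum_congr rfl fun j _ => ?_
    rw [pow_succ', Matrix.mul_apply, sum_mul]
    exact sum_congr rfl fun i _ => by ring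

theorem chromaticEval_cycleGraph {ι R : Type*} [Fintype ι] [DecidableEq ι] [CommRing R]
    (x : ι → R) (m : ℕ) :
    chromaticEval (SimpleGraph.cycleGraph (m + 2)) x = (offDiagonal x ^ (m + 2)).trace := by
  classical
  have hmem : ∀ κ : Fin (m + 2) → ι, κ ∈ properColoringFinset
      (SimpleGraph.cycleGraph (m + 2)) ↔ ∀ v, κ v ≠ κ (v + 1) := by
    intro κ
    rw [mem_properColoringFinset]
    constructor
    · intro h v
      exact h _ _ (by rw [SimpleGraph.cycleGraph_adj]; right; abel)
    · intro h u v huv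
      rw [SimpleGraph.cycleGraph_adj] at huv
      obtain huv | huv := huv
      · rw [sub_eq_iff_eq_add'.1 huv]
        exact (h v).symm
      · rw [sub_eq_iff_eq_add'.1 huv]
        exact h u
  have hfil : properColoringFinset (SimpleGraph.cycleGraph (m + 2)) =
      univ.filter fun κ : Fin (m + 2) → ι => ∀ v, κ v ≠ κ (v + 1) := by
    ext κ
    rw [hmem, mem_filter]
    simp
  have htr : (offDiagonal x ^ (m + 2)).trace =
      ∑ i, ∑ j, (offDiagonal x ^ (m + 1)) i j * offDiagonal x j i := by
    simp only [Matrix.trace, Matrix.diag_apply, pow_succ _ (m + 1), Matrix.mul_apply]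
  rw [htr, ← sum_walk_eq_pow (offDiagonal x) (m + 1) fun i j => offDiagonal x j i, chromaticEval,
    hfil, sum_filter]
  refine sum_congr rfl fun κ _ => ?_
  have hprod : (∏ k : Fin (m + 1), offDiagonal x (κ k.castSucc) (κ k.succ)) *
      offDiagonal x (κ (Fin.last (m + 1))) (κ 0) =
      ∏ k : Fin (m + 2), offDiagonal x (κ k) (κ (k + 1)) := by
    rw [Fin.prod_univ_castSucc (n := m + 1)]
    simp
  rw [hprod]
  simp only [offDiagonal]
  rw [prod_ite_zero]
  simp

theorem killCompl_starFunction (N : ℕ) {k : ℕ} (hk : k ≠ 0) :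
    MvPowerSeries.killCompl (R := ℚ) (Fin.valEmbedding (n := N)) (starFunction k) =
      ((starEval MvPolynomial.X k : MvPolynomial (Fin N) ℚ) :
        MvPowerSeries (Fin N) ℚ) := by
  obtain ⟨k, rfl⟩ := Nat.exists_eq_succ_of_ne_zero hk
  rw [← chromaticEval_starGraph, ← killCompl_chromaticSymmetricFunction]
  rfl

theorem killCompl_starBasis (N : ℕ) {n : ℕ} (p : n.Partition) :
    MvPowerSeries.killCompl (R := ℚ) (Fin.valEmbedding (n := N)) (starBasis p) =
      (((p.parts.map (starEval (MvPolynomial.X : Fin N → MvPolynomial (Fin N) ℚ))).prod :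
        MvPolynomial (Fin N) ℚ) : MvPowerSeries (Fin N) ℚ) := by
  rw [starBasis, map_multiset_prod, Multiset.map_map,
    ← MvPolynomial.coeToMvPowerSeries.ringHom_apply, map_multiset_prod, Multiset.map_map]
  refine congrArg _ (Multiset.map_congr rfl fun k hk => ?_)
  exact killCompl_starFunction N (p.parts_pos hk).ne'

end FiniteVariables

section LinearIndependence

open Finset

theorem injective_of_surjective_ringHom {A : Type*} [CommRing A] [IsNoetherianRing A] (f : A →+* A)
    (hf : Function.Surjective f) : Function.Injective f := by
  have hmono : Monotone fun m : ℕ => RingHom.ker (f ^ m) := by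
    refine monotone_nat_of_le_succ fun m a ha => ?_
    rw [RingHom.mem_ker] at ha ⊢
    rw [pow_succ', RingHom.mul_def, RingHom.comp_apply, ha, map_zero]
  obtain ⟨m, hm⟩ := monotone_stabilizes_iff_noetherian.2 ‹IsNoetherianRing A› ⟨_, hmono⟩
  rw [injective_iff_map_eq_zero]
  intro a ha
  obtain ⟨b, rfl⟩ : ∃ b, (f ^ m) b = a := by
    rw [RingHom.coe_pow]
    exact hf.iterate m a
  have hb : b ∈ RingHom.ker (f ^ (m + 1)) := by
    rw [RingHom.mem_ker, pow_succ', RingHom.mul_def, RingHom.comp_apply, ha]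
  have h := hm (m + 1) (Nat.le_succ m)
  simp only [OrderHom.coe_mk] at h
  rw [← h] at hb
  exact hb

theorem starEval_succ_eq_sum_psum {ι : Type*} [Fintype ι] (k : ℕ) :
    starEval (MvPolynomial.X : ι → MvPolynomial ι ℚ) (k + 1) =
      ∑ i ∈ range (k + 1), (-1) ^ i * (k.choose i : MvPolynomial ι ℚ) *
        MvPolynomial.psum ι ℚ 1 ^ (k - i) * MvPolynomial.psum ι ℚ (i + 1) := by
  have h1 : (∑ a, MvPolynomial.X a : MvPolynomial ι ℚ) = MvPolynomial.psum ι ℚ 1 := by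
    simp [MvPolynomial.psum]
  rw [starEval, h1, Nat.add_sub_cancel]
  have h2 : ∀ c : ι, (MvPolynomial.X c : MvPolynomial ι ℚ) *
      (MvPolynomial.psum ι ℚ 1 - MvPolynomial.X c) ^ k =
      ∑ i ∈ range (k + 1), (-1) ^ i * (k.choose i : MvPolynomial ι ℚ) *
        MvPolynomial.psum ι ℚ 1 ^ (k - i) * MvPolynomial.X c ^ (i + 1) := by
    intro c
    rw [sub_eq_neg_add, add_pow, mul_sum]
    refine sum_congr rfl fun i _ => ?_
    rw [neg_pow (MvPolynomial.X c : MvPolynomial ι ℚ)]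
    ring
  rw [sum_congr rfl fun c _ => h2 c, sum_comm]
  refine sum_congr rfl fun i _ => ?_
  rw [← mul_sum, MvPolynomial.psum.eq_def ι ℚ (i + 1)]

/-- The algebra generated by the first `n` star functions. -/
noncomputable def starAlgebra (n : ℕ) : Subalgebra ℚ (MvPolynomial (Fin n) ℚ) :=
  (MvPolynomial.aeval fun i : Fin n =>
    starEval (MvPolynomial.X : Fin n → MvPolynomial (Fin n) ℚ) (i + 1)).range

theorem starEval_mem_starAlgebra {n k : ℕ} (hk : k < n) :
    starEval (MvPolynomial.X : Fin n → MvPolynomial (Fin n) ℚ) (k + 1) ∈ starAlgebra n :=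
  ⟨MvPolynomial.X ⟨k, hk⟩, by simp⟩

theorem psum_mem_starAlgebra {n k : ℕ} (hk : k < n) :
    MvPolynomial.psum (Fin n) ℚ (k + 1) ∈ starAlgebra n := by
  induction k using Nat.strong_induction_on with
  | _ k ih =>
    have h := starEval_succ_eq_sum_psum (ι := Fin n) k
    rw [sum_range_succ] at h
    simp only [Nat.choose_self, Nat.cast_one, mul_one, Nat.sub_self, pow_zero] at h
    have h' : MvPolynomial.psum (Fin n) ℚ (k + 1) = (-1) ^ k *
        (starEval (MvPolynomial.X : Fin n → MvPolynomial (Fin n) ℚ) (k + 1) -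
          ∑ i ∈ range k, (-1) ^ i * (k.choose i : MvPolynomial (Fin n) ℚ) *
            MvPolynomial.psum (Fin n) ℚ 1 ^ (k - i) * MvPolynomial.psum (Fin n) ℚ (i + 1)) := by
      rw [h, add_sub_cancel_left, ← mul_assoc, ← mul_pow]
      simp
    have hneg : (-1 : MvPolynomial (Fin n) ℚ) ∈ starAlgebra n := neg_mem (one_mem _)
    rw [h']
    refine mul_mem (pow_mem hneg _) (sub_mem (starEval_mem_starAlgebra hk) (sum_mem fun i hi => ?_))
    rw [mem_range] at hi
    exact mul_mem (mul_mem (mul_mem (pow_mem hneg _) (natCast_mem _ _))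
      (pow_mem (ih 0 (by omega) (by omega)) _)) (ih i hi (by omega))

theorem esymm_mem_starAlgebra {n k : ℕ} (hk : k ≤ n) :
    MvPolynomial.esymm (Fin n) ℚ k ∈ starAlgebra n := by
  induction k using Nat.strong_induction_on with
  | _ k ih =>
    rcases Nat.eq_zero_or_pos k with rfl | hpos
    · simp [one_mem]
    have h := MvPolynomial.mul_esymm_eq_sum (Fin n) ℚ k
    have hneg : (-1 : MvPolynomial (Fin n) ℚ) ∈ starAlgebra n := neg_mem (one_mem _)
    have hmem : (k : MvPolynomial (Fin n) ℚ) * MvPolynomial.esymm (Fin n) ℚ k ∈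
        starAlgebra n := by
      rw [h]
      refine mul_mem (pow_mem hneg _) (sum_mem fun a ha => ?_)
      rw [mem_filter, HasAntidiagonal.mem_antidiagonal] at ha
      refine mul_mem (mul_mem (pow_mem hneg _) (ih _ ha.2 (by omega))) ?_
      obtain ⟨j, hj⟩ := Nat.exists_eq_succ_of_ne_zero (n := a.2) (by omega)
      rw [hj]
      exact psum_mem_starAlgebra (by omega)
    have h2 : MvPolynomial.esymm (Fin n) ℚ k =
        (k : ℚ)⁻¹ • ((k : MvPolynomial (Fin n) ℚ) * MvPolynomial.esymm (Fin n) ℚ k) := by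
      rw [← nsmul_eq_mul, ← Nat.cast_smul_eq_nsmul ℚ, smul_smul,
        inv_mul_cancel₀ (by positivity), one_smul]
    rw [h2]
    exact Subalgebra.smul_mem _ hmem _

theorem starEval_isSymmetric {ι : Type*} [Fintype ι] (k : ℕ) :
    (starEval (MvPolynomial.X : ι → MvPolynomial ι ℚ) k).IsSymmetric := by
  intro e
  simp only [starEval, map_sum, map_mul, map_pow, map_sub, MvPolynomial.rename_X]
  rw [Equiv.sum_comp e (fun a => (MvPolynomial.X a : MvPolynomial ι ℚ))]
  exact Equiv.sum_comp e fun c => (MvPolynomial.X c : MvPolynomial ι ℚ) *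
    (∑ a, MvPolynomial.X a - MvPolynomial.X c) ^ (k - 1)

theorem algebraicIndependent_starEval (n : ℕ) :
    AlgebraicIndependent ℚ fun i : Fin n =>
      starEval (MvPolynomial.X : Fin n → MvPolynomial (Fin n) ℚ) (i + 1) := by
  set φ : MvPolynomial (Fin n) ℚ →ₐ[ℚ] MvPolynomial (Fin n) ℚ :=
    MvPolynomial.aeval fun i : Fin n =>
      starEval (MvPolynomial.X : Fin n → MvPolynomial (Fin n) ℚ) (i + 1) with hφ
  have hsym : ∀ q, φ q ∈ MvPolynomial.symmetricSubalgebra (Fin n) ℚ := by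
    intro q
    induction q using MvPolynomial.induction_on with
    | C a => rw [← MvPolynomial.algebraMap_eq, AlgHom.commutes]; exact Subalgebra.algebraMap_mem _ _
    | add p q hp hq => rw [map_add]; exact add_mem hp hq
    | mul_X p i hp =>
      rw [map_mul]
      refine mul_mem hp ?_
      rw [hφ, MvPolynomial.aeval_X]
      exact starEval_isSymmetric _
  let E := MvPolynomial.esymmAlgEquiv (Fin n) ℚ (Fintype.card_fin n)
  let ψ : MvPolynomial (Fin n) ℚ →ₐ[ℚ] MvPolynomial (Fin n) ℚ :=
    (E.symm : _ →ₐ[ℚ] MvPolynomial (Fin n) ℚ).comp (φ.codRestrict _ hsym)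
  have hE : ∀ q, (E q : MvPolynomial (Fin n) ℚ) ∈ starAlgebra n := by
    intro q
    have h1 : (E q : MvPolynomial (Fin n) ℚ) =
        MvPolynomial.aeval (fun i : Fin n => MvPolynomial.esymm (Fin n) ℚ (i + 1)) q :=
      MvPolynomial.esymmAlgHom_apply q
    have h2 : (MvPolynomial.aeval (R := ℚ)
        fun i : Fin n => MvPolynomial.esymm (Fin n) ℚ (i + 1)).range ≤ starAlgebra n := by
      rw [← Algebra.adjoin_range_eq_range_aeval, Algebra.adjoin_le_iff]
      rintro _ ⟨i, rfl⟩
      exact esymm_mem_starAlgebra i.2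
    rw [h1]
    exact h2 ⟨q, rfl⟩
  have hsurj : Function.Surjective ψ := by
    intro q
    obtain ⟨r, hr⟩ := hE q
    refine ⟨r, ?_⟩
    have : φ.codRestrict _ hsym r = E q := Subtype.ext hr
    change E.symm (φ.codRestrict _ hsym r) = q
    rw [this, AlgEquiv.symm_apply_apply]
  have hinj : Function.Injective ψ :=
    injective_of_surjective_ringHom ψ.toRingHom hsurj
  intro p q hpq
  apply hinj
  have : φ.codRestrict _ hsym p = φ.codRestrict _ hsym q := Subtype.ext hpq
  change E.symm (φ.codRestrict _ hsym p) = E.symm (φ.codRestrict _ hsym q)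
  rw [this]

/-- The exponent vector of a partition of `n`, as a function on part sizes shifted by one. -/
noncomputable def partitionExponent {n : ℕ} (p : n.Partition) : Fin n →₀ ℕ :=
  Finsupp.equivFunOnFinite.symm fun i => p.parts.count ((i : ℕ) + 1)

theorem partitionExponent_injective (n : ℕ) :
    Function.Injective (partitionExponent : n.Partition → Fin n →₀ ℕ) := by
  intro p q h
  refine Nat.Partition.ext (Multiset.ext.2 fun a => ?_)
  by_cases ha : 0 < a ∧ a ≤ n
  · have := DFunLike.congr_fun h (⟨a - 1, by omega⟩ : Fin n)
    simpa [partitionExponent, Nat.sub_add_cancel ha.1] using this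
  · have hz : ∀ r : n.Partition, r.parts.count a = 0 := fun r =>
      Multiset.count_eq_zero.2 fun hr => ha ⟨r.parts_pos hr, r.le_of_mem_parts hr⟩
    rw [hz, hz]

@[to_additive]
theorem prod_map_parts_eq {R : Type*} [CommMonoid R] (s : ℕ → R) {n : ℕ} (p : n.Partition) :
    (p.parts.map s).prod = ∏ i ∈ Icc 1 n, s i ^ p.parts.count i := by
  classical
  rw [prod_multiset_map_count]
  refine prod_subset (fun i hi => ?_) fun i _ hi => ?_
  · rw [Multiset.mem_toFinset] at hi
    exact mem_Icc.2 ⟨p.parts_pos hi, p.le_of_mem_parts hi⟩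
  · rw [Multiset.mem_toFinset] at hi
    rw [Multiset.count_eq_zero.2 hi, pow_zero]

theorem linearIndependent_starBasis (n : ℕ) :
    LinearIndependent ℚ (starBasis : n.Partition → MvPowerSeries ℕ ℚ) := by
  rw [Fintype.linearIndependent_iff]
  intro g hg
  have hg1 : ∑ p : n.Partition, g p •
      ((p.parts.map (starEval (MvPolynomial.X : Fin n → MvPolynomial (Fin n) ℚ))).prod) = 0 := by
    have h := congrArg (MvPowerSeries.killCompl (R := ℚ) (Fin.valEmbedding (n := n))) hg
    simp only [map_sum, map_smul, map_zero, killCompl_starBasis] at h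
    apply MvPolynomial.coe_injective
    rw [← MvPolynomial.coeToMvPowerSeries.ringHom_apply, map_sum, MvPolynomial.coe_zero, ← h]
    refine sum_congr rfl fun p _ => ?_
    rw [MvPolynomial.coeToMvPowerSeries.ringHom_apply, MvPolynomial.coe_smul]
  have hg2 : MvPolynomial.aeval (fun i : Fin n =>
      starEval (MvPolynomial.X : Fin n → MvPolynomial (Fin n) ℚ) (i + 1))
      (∑ p : n.Partition, MvPolynomial.monomial (partitionExponent p) (g p)) = 0 := by
    rw [map_sum, ← hg1]
    refine sum_congr rfl fun p _ => ?_
    rw [MvPolynomial.aeval_monomial, prod_map_parts_eq, Algebra.smul_def]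
    congr 1
    rw [Finsupp.prod_fintype _ _ (by simp), ← Ico_add_one_right_eq_Icc]
    rw [prod_Ico_eq_prod_range, prod_range]
    refine prod_congr rfl fun i _ => ?_
    simp [partitionExponent, add_comm]
  have hz := (algebraicIndependent_iff.1 (algebraicIndependent_starEval n)) _ hg2
  intro p
  have hc := congrArg (MvPolynomial.coeff (partitionExponent p)) hz
  rw [MvPolynomial.coeff_sum, sum_eq_single p] at hc
  · simpa using hc
  · intro q _ hqp
    rw [MvPolynomial.coeff_monomial, if_neg fun h => hqp (partitionExponent_injective n h)]
  · simp

end LinearIndependence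

section GeneratingFunctions

open Finset PowerSeries

variable {R : Type*} [CommRing R]

/-- The geometric series `1 / (1 - a X)`. -/
noncomputable def geometricSeries (a : R) : R⟦X⟧ := PowerSeries.mk fun n => a ^ n

theorem one_sub_mul_geometricSeries (a : R) : (1 - C a * X) * geometricSeries a = 1 := by
  ext n
  rw [sub_mul, one_mul, map_sub, mul_assoc, coeff_C_mul, geometricSeries]
  cases n with
  | zero => simp
  | succ n => simp [coeff_succ_X_mul, pow_succ', coeff_one]

theorem coeff_geometricSeries_pow (a : R) (d j : ℕ) :
    coeff j (geometricSeries a ^ (d + 1)) = a ^ j * ((d + j).choose j : R) := by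
  have h : geometricSeries a = rescale a (PowerSeries.mk 1) := by
    ext n
    simp [geometricSeries]
  rw [h, ← map_pow, mk_one_pow_eq_mk_choose_add, coeff_rescale, coeff_mk]
  rw [Nat.choose_symm_add]

/-- The Euler operator `X d/dX`. -/
noncomputable def eulerOperator (f : R⟦X⟧) : R⟦X⟧ := X * d⁄dX R f

theorem coeff_eulerOperator (f : R⟦X⟧) (n : ℕ) : coeff n (eulerOperator f) = n * coeff n f := by
  cases n with
  | zero => simp [eulerOperator]
  | succ n =>
    rw [eulerOperator, coeff_succ_X_mul, coeff_derivative]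
    push_cast
    ring

theorem eulerOperator_mul (f g : R⟦X⟧) :
    eulerOperator (f * g) = eulerOperator f * g + f * eulerOperator g := by
  simp only [eulerOperator, Derivation.leibniz, smul_eq_mul]
  ring

theorem eulerOperator_sum {ι : Type*} (s : Finset ι) (f : ι → R⟦X⟧) :
    eulerOperator (∑ i ∈ s, f i) = ∑ i ∈ s, eulerOperator (f i) := by
  simp only [eulerOperator, map_sum, mul_sum]

theorem eulerOperator_sub (f g : R⟦X⟧) :
    eulerOperator (f - g) = eulerOperator f - eulerOperator g := by
  simp only [eulerOperator, map_sub, mul_sub]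

theorem eulerOperator_C_mul_X (a : R) : eulerOperator (C a * X) = C a * X := by
  simp only [eulerOperator, Derivation.leibniz, smul_eq_mul, derivative_X, derivative_C]
  ring

theorem eulerOperator_one : eulerOperator (1 : R⟦X⟧) = 0 := by
  simp [eulerOperator]

theorem eulerOperator_pow_succ (f : R⟦X⟧) (m : ℕ) :
    eulerOperator (f ^ (m + 1)) = (m + 1 : R⟦X⟧) * (f ^ m * eulerOperator f) := by
  simp only [eulerOperator, derivative_pow]
  push_cast
  ring_nf

theorem eulerOperator_geometricSeries (a : R) :
    eulerOperator (geometricSeries a) = C a * X * geometricSeries a ^ 2 := by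
  have h := one_sub_mul_geometricSeries a
  have h2 := congrArg eulerOperator h
  rw [eulerOperator_mul, eulerOperator_sub, eulerOperator_one, eulerOperator_C_mul_X] at h2
  linear_combination geometricSeries a * h2 - eulerOperator (geometricSeries a) * h

variable {ι : Type*} [Fintype ι]

/-- The alternating power sum series `∑ i, x i X / (1 + x i X)`. -/
noncomputable def powerSumSeries (x : ι → R) : R⟦X⟧ :=
  ∑ i, C (x i) * X * geometricSeries (-x i)

theorem one_add_mul_geometricSeries_neg (a : R) :
    (1 + C a * X) * geometricSeries (-a) = 1 := by
  have h := one_sub_mul_geometricSeries (-a)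
  rw [map_neg] at h
  linear_combination h

theorem eulerOperator_powerSumSeries (x : ι → R) :
    eulerOperator (powerSumSeries x) = ∑ i, C (x i) * X * geometricSeries (-x i) ^ 2 := by
  rw [powerSumSeries, eulerOperator_sum]
  refine sum_congr rfl fun i _ => ?_
  rw [eulerOperator_mul, eulerOperator_C_mul_X, eulerOperator_geometricSeries, map_neg]
  linear_combination (-C (x i) * X * geometricSeries (-x i)) *
    one_add_mul_geometricSeries_neg (x i)

/-- The generating function of the traces of powers of a matrix. -/
noncomputable def traceSeries [DecidableEq ι] (B : Matrix ι ι R) : R⟦X⟧ :=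
  PowerSeries.mk fun n => (B ^ n).trace

theorem one_sub_powerSumSeries_mul_traceSeries [DecidableEq ι] (x : ι → R) :
    (1 - powerSumSeries x) *
      (traceSeries (offDiagonal x) + powerSumSeries x - (Fintype.card ι : R⟦X⟧)) =
      eulerOperator (powerSumSeries x) := by
  let Q : ι → ι → R⟦X⟧ := fun i j => PowerSeries.mk fun n => (offDiagonal x ^ n) i j
  let S : ι → R⟦X⟧ := fun j => ∑ i, Q i j
  have hQ : ∀ i j, (1 + C (x i) * X) * Q i j = (if i = j then 1 else 0) + C (x i) * X * S j := by
    intro i j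
    have h : Q i j = (if i = j then 1 else 0) + C (x i) * (X * (S j - Q i j)) := by
      ext n
      rw [map_add, coeff_C_mul]
      cases n with
      | zero => by_cases hij : i = j <;> simp [Q, hij]
      | succ n =>
        rw [coeff_succ_X_mul, map_sub, map_sum]
        have hz : coeff (n + 1) (if i = j then (1 : R⟦X⟧) else 0) = 0 := by
          split_ifs <;> simp [coeff_one]
        rw [hz, zero_add]
        simp only [Q, coeff_mk]
        rw [pow_succ', Matrix.mul_apply, ← sum_erase_eq_sub (mem_univ i), mul_sum]
        symm
        rw [← filter_ne, sum_filter]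
        refine sum_congr rfl fun k _ => ?_
        by_cases hik : i = k <;> simp [offDiagonal, hik]
    linear_combination h
  have hQ' : ∀ i j, Q i j = (if i = j then geometricSeries (-x i) else 0) +
      C (x i) * X * geometricSeries (-x i) * S j := by
    intro i j
    have h1 := hQ i j
    have h2 := one_add_mul_geometricSeries_neg (x i)
    split_ifs at h1 ⊢ with hij
    · linear_combination geometricSeries (-x i) * h1 - Q i j * h2
    · linear_combination geometricSeries (-x i) * h1 - Q i j * h2
  have hS : ∀ j, (1 - powerSumSeries x) * S j = geometricSeries (-x j) := by
    intro j
    have h : S j = geometricSeries (-x j) + powerSumSeries x * S j := by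
      change ∑ i, Q i j = _
      rw [sum_congr rfl fun i _ => hQ' i j, sum_add_distrib, powerSumSeries, sum_mul]
      simp
    linear_combination h
  have htr : traceSeries (offDiagonal x) = ∑ i, Q i i := by
    ext n
    rw [map_sum]
    simp [traceSeries, Q, Matrix.trace]
  have hcard : ∑ i, geometricSeries (-x i) = (Fintype.card ι : R⟦X⟧) - powerSumSeries x := by
    rw [powerSumSeries, eq_sub_iff_add_eq, ← sum_add_distrib]
    rw [sum_congr rfl fun i _ => (by ring : geometricSeries (-x i) + C (x i) * X *
      geometricSeries (-x i) = (1 + C (x i) * X) * geometricSeries (-x i))]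
    simp [one_add_mul_geometricSeries_neg]
  have htr2 : traceSeries (offDiagonal x) = (Fintype.card ι : R⟦X⟧) - powerSumSeries x +
      ∑ i, C (x i) * X * geometricSeries (-x i) * S i := by
    rw [htr, sum_congr rfl fun i _ => hQ' i i, sum_add_distrib, ← hcard]
    simp
  rw [htr2, eulerOperator_powerSumSeries]
  calc _ = ∑ i, C (x i) * X * geometricSeries (-x i) * ((1 - powerSumSeries x) * S i) := by
        rw [sub_add_eq_add_sub, sub_add_cancel, add_sub_cancel_left, mul_sum]
        exact sum_congr rfl fun i _ => by ring
    _ = _ := sum_congr rfl fun i _ => by rw [hS]; ring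

/-- The series `∑_{k ≥ 2} 𝔰𝔱_k w^k` at `w = X / (1 + s X)`. -/
noncomputable def starSeries (x : ι → R) : R⟦X⟧ :=
  powerSumSeries x - C (∑ i, x i) * X * geometricSeries (-∑ i, x i)

/-- The series `∑_{k ≥ 2} 𝔰𝔱_k X^k / (1 + s X)^(k - 1)`. -/
noncomputable def scaledStarSeries (x : ι → R) : R⟦X⟧ :=
  (1 + C (∑ i, x i) * X) * starSeries x

theorem one_sub_scaledStarSeries_mul [DecidableEq ι] (x : ι → R) :
    (1 - scaledStarSeries x) *
      (traceSeries (offDiagonal x) - (Fintype.card ι : R⟦X⟧) + starSeries x) =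
      eulerOperator (scaledStarSeries x) := by
  have h := one_sub_powerSumSeries_mul_traceSeries x
  have hv := one_add_mul_geometricSeries_neg (∑ i, x i)
  have hT : scaledStarSeries x =
      1 - (1 + C (∑ i, x i) * X) * (1 - powerSumSeries x) := by
    rw [scaledStarSeries, starSeries]
    linear_combination (-C (∑ i, x i) * X) * hv
  have hD : eulerOperator (scaledStarSeries x) = (1 + C (∑ i, x i) * X) *
      eulerOperator (powerSumSeries x) - C (∑ i, x i) * X * (1 - powerSumSeries x) := by
    have h1 : eulerOperator (1 + C (∑ i, x i) * X) = C (∑ i, x i) * X := by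
      rw [← sub_neg_eq_add, eulerOperator_sub, eulerOperator_one, ← neg_mul, ← map_neg,
        eulerOperator_C_mul_X, map_neg]
      ring
    rw [hT, eulerOperator_sub, eulerOperator_one, eulerOperator_mul, h1, eulerOperator_sub,
      eulerOperator_one]
    ring
  rw [hD, hT, starSeries, ← h]
  linear_combination (-C (∑ i, x i) * X * (1 - powerSumSeries x)) * hv

theorem X_pow_dvd_starSeries_sub (x : ι → R) {n : ℕ} (hn : 1 ≤ n) :
    X ^ (n + 1) ∣ starSeries x -
      ∑ k ∈ Icc 2 n, C (starEval x k) * (X * geometricSeries (-∑ i, x i)) ^ k := by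
  set s := ∑ i, x i with hs
  set w := X * geometricSeries (-s) with hw
  have hv := one_add_mul_geometricSeries_neg s
  have hc : ∀ c, X ^ (n + 1) ∣ C (x c) * X * geometricSeries (-x c) -
      C (x c) * w * ∑ k ∈ range n, (C (s - x c) * w) ^ k := by
    intro c
    have hu := one_add_mul_geometricSeries_neg (x c)
    have h1 : C (x c) * X * geometricSeries (-x c) * (1 - C (s - x c) * w) = C (x c) * w := by
      rw [hw, map_sub]
      linear_combination (C (x c) * X * geometricSeries (-s)) * hu -
        (C (x c) * X * geometricSeries (-x c)) * hv
    have h2 := mul_neg_geom_sum (C (s - x c) * w) n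
    have h3 : C (x c) * X * geometricSeries (-x c) -
        C (x c) * w * ∑ k ∈ range n, (C (s - x c) * w) ^ k =
        C (x c) * X * geometricSeries (-x c) * (C (s - x c) * w) ^ n := by
      rw [← h1]
      linear_combination (-C (x c) * X * geometricSeries (-x c)) * h2
    rw [h3, hw, mul_pow, mul_pow, pow_succ]
    exact ⟨C (x c) * geometricSeries (-x c) * C (s - x c) ^ n * geometricSeries (-s) ^ n,
      by ring⟩
  have hsum : starSeries x - ∑ k ∈ Icc 2 n, C (starEval x k) * w ^ k =
      ∑ c, (C (x c) * X * geometricSeries (-x c) -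
        C (x c) * w * ∑ k ∈ range n, (C (s - x c) * w) ^ k) := by
    have h1 : ∑ c, C (x c) * w * ∑ k ∈ range n, (C (s - x c) * w) ^ k =
        ∑ k ∈ Icc 1 n, C (starEval x k) * w ^ k := by
      simp only [mul_sum]
      rw [sum_comm, ← Ico_add_one_right_eq_Icc, sum_Ico_eq_sum_range]
      refine sum_congr (by simp) fun k _ => ?_
      rw [starEval, map_sum, sum_mul]
      refine sum_congr rfl fun c _ => ?_
      rw [Nat.add_sub_cancel_left, ← hs, map_mul, map_pow]
      ring
    have h2 : Icc 1 n = insert 1 (Icc 2 n) := by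
      ext k
      rw [mem_insert, mem_Icc, mem_Icc]
      omega
    rw [sum_sub_distrib, h1, h2, sum_insert (by simp), starSeries, powerSumSeries]
    rw [starEval, ← hs, hw]
    simp only [Nat.sub_self, pow_zero, mul_one, pow_one, ← hs]
    ring
  rw [hsum]
  exact dvd_sum fun c _ => hc c

end GeneratingFunctions

section CoefficientExtraction

open Finset PowerSeries

theorem coeff_eq_of_X_pow_dvd_sub {R : Type*} [CommRing R] {f g : R⟦X⟧} {n : ℕ}
    (h : X ^ (n + 1) ∣ f - g) : coeff n f = coeff n g := by
  have := X_pow_dvd_iff.1 h n (Nat.lt_succ_self n)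
  rwa [map_sub, sub_eq_zero] at this

/-- The coefficients of `X T' / (1 - T)`, the Euler derivative of `-log (1 - T)`. -/
theorem coeff_of_one_sub_mul_eq_eulerOperator {R : Type*} [CommRing R] [Algebra ℚ R]
    {T F : R⟦X⟧} (hT : X ∣ T) (hF : (1 - T) * F = eulerOperator T) (n : ℕ) :
    coeff n F = ∑ m ∈ Icc 1 n, ((n : ℚ) / m) • coeff n (T ^ m) := by
  have hXF : X ∣ F := by
    have : F = T * F + eulerOperator T := by linear_combination hF
    rw [this]
    exact dvd_add (hT.mul_right _) (dvd_mul_right _ _)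
  have h1 : F - ∑ m ∈ range n, T ^ m * eulerOperator T = T ^ n * F := by
    rw [← sum_mul, ← hF]
    linear_combination (-F) * mul_neg_geom_sum T n
  have h2 : X ^ (n + 1) ∣ F - ∑ m ∈ range n, T ^ m * eulerOperator T := by
    rw [h1, pow_succ]
    exact mul_dvd_mul (pow_dvd_pow_of_dvd hT n) hXF
  rw [coeff_eq_of_X_pow_dvd_sub h2, map_sum, ← Ico_add_one_right_eq_Icc, sum_Ico_eq_sum_range]
  refine sum_congr (by simp) fun m _ => ?_
  have h3 := congrArg (coeff n) (eulerOperator_pow_succ T m)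
  have h4 : ((m + 1 : ℕ) : R⟦X⟧) = C ((m + 1 : ℕ) : R) := by simp
  rw [coeff_eulerOperator, ← Nat.cast_succ, Nat.succ_eq_add_one, h4, coeff_C_mul,
    ← nsmul_eq_mul, ← nsmul_eq_mul] at h3
  have h5 : ((m + 1 : ℕ) : ℚ) • coeff n (T ^ m * eulerOperator T) =
      (n : ℚ) • coeff n (T ^ (m + 1)) := by
    rw [Nat.cast_smul_eq_nsmul, Nat.cast_smul_eq_nsmul, h3]
  have hne : ((m + 1 : ℕ) : ℚ) ≠ 0 := by positivity
  rw [add_comm 1 m, div_eq_inv_mul, ← smul_smul, ← h5, smul_smul, inv_mul_cancel₀ hne, one_smul]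

variable {R ι : Type*} [CommRing R] [Fintype ι]

theorem X_pow_dvd_scaledStarSeries_sub (x : ι → R) {n : ℕ} (hn : 1 ≤ n) :
    X ^ (n + 1) ∣ scaledStarSeries x -
      ∑ k ∈ Icc 2 n, C (starEval x k) * (X ^ k * geometricSeries (-∑ i, x i) ^ (k - 1)) := by
  have h := (X_pow_dvd_starSeries_sub x hn).mul_left (1 + C (∑ i, x i) * X)
  have hk : ∀ k ∈ Icc 2 n, (1 + C (∑ i, x i) * X) *
      (C (starEval x k) * (X * geometricSeries (-∑ i, x i)) ^ k) =
      C (starEval x k) * (X ^ k * geometricSeries (-∑ i, x i) ^ (k - 1)) := by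
    intro k hk
    obtain ⟨j, rfl⟩ := Nat.exists_eq_add_of_le (le_trans one_le_two (mem_Icc.1 hk).1)
    rw [Nat.add_sub_cancel_left]
    linear_combination (C (starEval x (1 + j)) * X ^ (1 + j) * geometricSeries (-∑ i, x i) ^ j) *
      one_add_mul_geometricSeries_neg (∑ i, x i)
  rw [mul_sub, mul_sum, sum_congr rfl hk] at h
  exact h

theorem X_dvd_scaledStarSeries (x : ι → R) : X ∣ scaledStarSeries x := by
  have h := X_pow_dvd_scaledStarSeries_sub x le_rfl
  rw [Icc_eq_empty (by norm_num), sum_empty, sub_zero] at h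
  exact (dvd_pow_self X two_ne_zero).trans h

theorem coeff_X_pow_mul_geometricSeries_pow (a : R) (K d n : ℕ) :
    coeff n (X ^ K * geometricSeries a ^ (d + 1)) =
      if K ≤ n then a ^ (n - K) * ((d + (n - K)).choose (n - K) : R) else 0 := by
  rw [coeff_X_pow_mul']
  split_ifs
  · rw [coeff_geometricSeries_pow]
  · rfl

theorem coeff_starSeries (x : ι → R) {n : ℕ} (hn : 1 ≤ n) :
    coeff n (starSeries x) = ∑ k ∈ Icc 2 n,
      (-1) ^ (n - k) * ((n - 1).choose (n - k) : R) * (starEval x k * (∑ i, x i) ^ (n - k)) := by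
  rw [coeff_eq_of_X_pow_dvd_sub (X_pow_dvd_starSeries_sub x hn), map_sum]
  refine sum_congr rfl fun k hk => ?_
  rw [mem_Icc] at hk
  obtain ⟨j, rfl⟩ := Nat.exists_eq_add_of_le (le_trans one_le_two hk.1)
  rw [coeff_C_mul, mul_pow, add_comm 1 j, coeff_X_pow_mul_geometricSeries_pow,
    if_pos (by omega), neg_pow, show j + (n - (j + 1)) = n - 1 by omega]
  ring

/-- The expansion of the coefficients of powers of `scaledStarSeries`. -/
theorem coeff_scaledStarSeries_pow (x : ι → R) {n m : ℕ} (hn : 1 ≤ n) (hm : 1 ≤ m) :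
    coeff n (scaledStarSeries x ^ m) = ∑ k ∈ piAntidiag (Icc 2 n) m,
      if ∑ i ∈ Icc 2 n, i * k i ≤ n then
        (-1) ^ (n - ∑ i ∈ Icc 2 n, i * k i) * (Nat.multinomial (Icc 2 n) k : R) *
          ((n - 1 - m).choose (n - ∑ i ∈ Icc 2 n, i * k i) : R) *
          ((∏ i ∈ Icc 2 n, starEval x i ^ k i) * (∑ i, x i) ^ (n - ∑ i ∈ Icc 2 n, i * k i))
      else 0 := by
  have h := (X_pow_dvd_scaledStarSeries_sub x hn).trans (sub_dvd_pow_sub_pow _ _ m)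
  rw [coeff_eq_of_X_pow_dvd_sub h, sum_pow_eq_sum_piAntidiag, map_sum]
  refine sum_congr rfl fun k hk => ?_
  rw [mem_piAntidiag] at hk
  set K := ∑ i ∈ Icc 2 n, i * k i with hK
  have h1 : ∑ i ∈ Icc 2 n, (i - 1) * k i + m = K := by
    rw [hK, ← hk.1, ← sum_add_distrib]
    refine sum_congr rfl fun i hi => ?_
    obtain ⟨j, rfl⟩ := Nat.exists_eq_add_of_le (le_trans one_le_two (mem_Icc.1 hi).1)
    rw [Nat.add_sub_cancel_left]
    ring
  have h2 : m ≤ ∑ i ∈ Icc 2 n, (i - 1) * k i := by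
    rw [← hk.1]
    refine sum_le_sum fun i hi => ?_
    have := (mem_Icc.1 hi).1
    exact Nat.le_mul_of_pos_left _ (by omega)
  obtain ⟨d, hd⟩ := Nat.exists_eq_succ_of_ne_zero
    (n := ∑ i ∈ Icc 2 n, (i - 1) * k i) (by omega)
  have h3 : ∏ i ∈ Icc 2 n, (C (starEval x i) * (X ^ i * geometricSeries (-∑ i, x i) ^ (i - 1))) ^ k i
      = C (∏ i ∈ Icc 2 n, starEval x i ^ k i) *
        (X ^ K * geometricSeries (-∑ i, x i) ^ (d + 1)) := by
    simp only [mul_pow, prod_mul_distrib, ← pow_mul, prod_pow_eq_pow_sum, map_prod, map_pow]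
    rw [hd, hK]
  have h4 : (Nat.multinomial (Icc 2 n) k : R⟦X⟧) = C (Nat.multinomial (Icc 2 n) k : R) := by simp
  rw [h3, h4, coeff_C_mul, coeff_C_mul, coeff_X_pow_mul_geometricSeries_pow]
  split_ifs with hle
  · rw [neg_pow (∑ i, x i), show d + (n - K) = n - 1 - m by omega]
    ring
  · simp

end CoefficientExtraction

section Partitions

open Finset PowerSeries

theorem Icc_one_eq_insert {n : ℕ} (hn : 1 ≤ n) : Icc 1 n = insert 1 (Icc 2 n) := by
  ext k
  rw [mem_insert, mem_Icc, mem_Icc]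
  omega

theorem partMult_one_add_sum {n : ℕ} (hn : 1 ≤ n) (p : n.Partition) :
    partMult p 1 + ∑ i ∈ Icc 2 n, i * partMult p i = n := by
  have h := sum_map_parts_eq (fun i : ℕ => i) p
  rw [Multiset.map_id', p.parts_sum, Icc_one_eq_insert hn, sum_insert (by simp)] at h
  simp only [smul_eq_mul, mul_one] at h
  simpa [partMult, mul_comm] using h.symm

theorem partLength_eq_add_sum {n : ℕ} (hn : 1 ≤ n) (p : n.Partition) :
    partLength p = partMult p 1 + ∑ i ∈ Icc 2 n, partMult p i := by
  have h := sum_map_parts_eq (fun _ : ℕ => 1) p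
  rw [Icc_one_eq_insert hn, sum_insert (by simp)] at h
  simpa [partLength, partMult] using h

theorem partLength_le {n : ℕ} (hn : 1 ≤ n) (p : n.Partition) : partLength p ≤ n := by
  rw [partLength_eq_add_sum hn]
  conv_rhs => rw [← partMult_one_add_sum hn p]
  refine Nat.add_le_add_left (sum_le_sum fun i hi => ?_) _
  have := (mem_Icc.1 hi).1
  exact Nat.le_mul_of_pos_left _ (by omega)

theorem prod_map_starEval {R ι : Type*} [CommRing R] [Fintype ι] (x : ι → R) {n : ℕ} (hn : 1 ≤ n)
    (p : n.Partition) : (p.parts.map (starEval x)).prod =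
      (∏ i ∈ Icc 2 n, starEval x i ^ partMult p i) * (∑ i, x i) ^ partMult p 1 := by
  rw [prod_map_parts_eq, Icc_one_eq_insert hn, prod_insert (by simp), mul_comm]
  simp [partMult, starEval]

theorem exists_partition_partMult_eq {n : ℕ} (k : ℕ → ℕ)
    (hk : ∑ i ∈ Icc 2 n, i * k i ≤ n) :
    ∃ p : n.Partition, partMult p 1 = n - ∑ i ∈ Icc 2 n, i * k i ∧
      ∀ i ∈ Icc 2 n, partMult p i = k i := by
  refine ⟨⟨Multiset.replicate (n - ∑ i ∈ Icc 2 n, i * k i) 1 +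
    ∑ i ∈ Icc 2 n, Multiset.replicate (k i) i, ?_, ?_⟩, ?_, ?_⟩
  · intro i hi
    rw [Multiset.mem_add, Multiset.mem_sum] at hi
    obtain hi | ⟨j, hj, hi⟩ := hi
    · rw [Multiset.eq_of_mem_replicate hi]
      exact one_pos
    · rw [Multiset.eq_of_mem_replicate hi]
      exact lt_of_lt_of_le two_pos (mem_Icc.1 hj).1
  · rw [Multiset.sum_add, ← Multiset.coe_sumAddMonoidHom, map_sum]
    simp only [Multiset.coe_sumAddMonoidHom, Multiset.sum_replicate, smul_eq_mul, mul_one]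
    simp only [mul_comm (k _)]
    omega
  · simp only [partMult, Multiset.count_add, Multiset.count_replicate_self, Multiset.count_sum']
    refine Nat.add_eq_left.2 (sum_eq_zero fun i hi => ?_)
    rw [Multiset.count_replicate, if_neg]
    have := (mem_Icc.1 hi).1
    omega
  · intro i hi
    have hi2 := (mem_Icc.1 hi).1
    simp only [partMult, Multiset.count_add, Multiset.count_sum', Multiset.count_replicate]
    rw [if_neg (by omega), zero_add, sum_ite_eq', if_pos hi]

/-- The coefficients of the star expansion of the logarithmic part. -/
def logCoeff {n : ℕ} (p : n.Partition) : ℚ :=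
  (-1 : ℚ) ^ partMult p 1 *
    ((n : ℚ) / ((partLength p : ℚ) - (partMult p 1 : ℚ))
      * (Nat.multinomial (Finset.Icc 2 n) (partMult p) : ℚ)
      * ((n - partLength p + partMult p 1 - 1).choose (partMult p 1) : ℚ))

variable {R ι : Type*} [CommRing R] [Fintype ι]

theorem coeff_scaledStarSeries_pow_eq_sum_partition (x : ι → R) {n m : ℕ} (hn : 1 ≤ n)
    (hm : 1 ≤ m) :
    coeff n (scaledStarSeries x ^ m) =
      ∑ p : n.Partition with partLength p = partMult p 1 + m,
        (-1) ^ partMult p 1 * (Nat.multinomial (Icc 2 n) (partMult p) : R) *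
          ((n - partLength p + partMult p 1 - 1).choose (partMult p 1) : R) *
          (p.parts.map (starEval x)).prod := by
  rw [coeff_scaledStarSeries_pow x hn hm, ← sum_filter]
  symm
  have hsum : ∀ p : n.Partition, ∀ f : ℕ → ℕ → ℕ,
      ∑ i ∈ Icc 2 n, f i (if i ∈ Icc 2 n then partMult p i else 0) =
        ∑ i ∈ Icc 2 n, f i (partMult p i) := fun p f =>
    sum_congr rfl fun i hi => by rw [if_pos hi]
  refine sum_nbij (fun p i => if i ∈ Icc 2 n then partMult p i else 0) ?_ ?_ ?_ ?_
  · intro p hp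
    rw [mem_filter] at hp
    have h1 := partMult_one_add_sum hn p
    have h2 := partLength_eq_add_sum hn p
    rw [mem_filter, mem_piAntidiag, hsum p fun i a => i * a, hsum p fun _ a => a]
    refine ⟨⟨by omega, fun i hi => ?_⟩, by omega⟩
    by_contra h
    exact hi (if_neg h)
  · intro p _ q _ hpq
    have hpq' : ∀ i ∈ Icc 2 n, partMult p i = partMult q i := by
      intro i hi
      have := congrFun hpq i
      simpa only [if_pos hi] using this
    refine Nat.Partition.ext (Multiset.ext.2 fun a => ?_)
    have h1 := partMult_one_add_sum hn p
    have h2 := partMult_one_add_sum hn q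
    rw [sum_congr rfl fun i hi => by rw [hpq' i hi]] at h1
    by_cases ha : a = 1
    · subst ha
      change partMult p 1 = partMult q 1
      omega
    by_cases ha' : a ∈ Icc 2 n
    · exact hpq' a ha'
    have hz : ∀ r : n.Partition, r.parts.count a = 0 := fun r =>
      Multiset.count_eq_zero.2 fun hr => ha' (mem_Icc.2
        ⟨by have := r.parts_pos hr; omega, r.le_of_mem_parts hr⟩)
    rw [hz, hz]
  · intro k hk
    rw [mem_coe, mem_filter, mem_piAntidiag] at hk
    obtain ⟨p, hp1, hp2⟩ := exists_partition_partMult_eq k hk.2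
    have hk' : (fun i => if i ∈ Icc 2 n then partMult p i else 0) = k := by
      funext i
      split_ifs with hi
      · exact hp2 i hi
      · by_contra h
        exact hi (hk.1.2 i (Ne.symm h))
    refine ⟨p, ?_, hk'⟩
    rw [mem_coe, mem_filter, partLength_eq_add_sum hn, sum_congr rfl hp2, hk.1.1]
    exact ⟨mem_univ _, rfl⟩
  · intro p hp
    rw [mem_filter] at hp
    have h1 := partMult_one_add_sum hn p
    have h2 := partLength_le hn p
    rw [hsum p fun i a => i * a, prod_map_starEval x hn,
      Nat.multinomial_congr (g := partMult p) fun i hi => if_pos hi,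
      prod_congr rfl fun i hi =>
        congrArg (starEval x i ^ ·) (if_pos hi : (if i ∈ Icc 2 n then partMult p i else 0) = _),
      show n - ∑ i ∈ Icc 2 n, i * partMult p i = partMult p 1 by omega,
      show n - partLength p + partMult p 1 - 1 = n - 1 - m by omega]

theorem sum_coeff_scaledStarSeries_pow [Algebra ℚ R] (x : ι → R) {n : ℕ} (hn : 1 ≤ n) :
    ∑ m ∈ Icc 1 n, ((n : ℚ) / m) • coeff n (scaledStarSeries x ^ m) =
      ∑ p : n.Partition, logCoeff p • (p.parts.map (starEval x)).prod := by
  rw [sum_congr rfl fun m hm => by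
    rw [coeff_scaledStarSeries_pow_eq_sum_partition x hn (mem_Icc.1 hm).1, sum_filter, smul_sum],
    sum_comm]
  refine sum_congr rfl fun p _ => ?_
  have h2 := partLength_eq_add_sum hn p
  have h3 := partLength_le hn p
  by_cases hl : partLength p = partMult p 1
  · rw [logCoeff, hl, sub_self, div_zero, zero_mul, zero_mul, mul_zero, zero_smul]
    refine sum_eq_zero fun m hm => ?_
    have := (mem_Icc.1 hm).1
    rw [if_neg (by omega), smul_zero]
  · rw [sum_eq_single (partLength p - partMult p 1)]
    · rw [if_pos (by omega), logCoeff, Nat.cast_sub (by omega)]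
      simp only [Algebra.smul_def, map_mul, map_pow, map_neg, map_one, map_natCast]
      ring
    · intro m _ hm
      rw [if_neg (by omega), smul_zero]
    · intro h
      exact absurd (mem_Icc.2 ⟨by omega, by omega⟩) h

theorem IsProperHook.two_le {n : ℕ} {p : n.Partition} (hp : IsProperHook p) :
    2 ≤ n - partMult p 1 := by
  have h := p.parts_pos (i := n - partMult p 1) (by rw [hp.1]; exact Multiset.mem_cons_self _ _)
  have := hp.2
  omega

theorem isProperHook_of_parts_eq {n k : ℕ} (hk : 2 ≤ k) (hkn : k ≤ n) {p : n.Partition}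
    (hp : p.parts = k ::ₘ Multiset.replicate (n - k) 1) :
    partMult p 1 = n - k ∧ IsProperHook p := by
  have h : partMult p 1 = n - k := by
    rw [partMult, hp, Multiset.count_cons_of_ne (by omega), Multiset.count_replicate_self]
  refine ⟨h, ?_, by omega⟩
  rw [h, hp, show n - (n - k) = k by omega]

theorem coeff_starSeries_eq_sum_partition [Algebra ℚ R] (x : ι → R) {n : ℕ} (hn : 1 ≤ n) :
    coeff n (starSeries x) = ∑ p : n.Partition,
      (if IsProperHook p then (-1 : ℚ) ^ partMult p 1 * ((n - 1).choose (partMult p 1) : ℚ) else 0) •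
        (p.parts.map (starEval x)).prod := by
  rw [coeff_starSeries x hn]
  simp only [ite_smul, zero_smul]
  rw [← sum_filter]
  symm
  refine sum_nbij (fun p => n - partMult p 1) ?_ ?_ ?_ ?_
  · intro p hp
    rw [mem_filter] at hp
    exact mem_Icc.2 ⟨hp.2.two_le, Nat.sub_le _ _⟩
  · intro p hp q hq hpq
    rw [mem_coe, mem_filter] at hp hq
    have h1 := hp.2.two_le
    have h2 := hq.2.two_le
    refine Nat.Partition.ext ?_
    rw [hp.2.1, hq.2.1, show partMult p 1 = partMult q 1 by simp only at hpq; omega]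
  · intro k hk
    rw [mem_coe, mem_Icc] at hk
    have hp : ∃ p : n.Partition, p.parts = k ::ₘ Multiset.replicate (n - k) 1 := by
      refine ⟨⟨k ::ₘ Multiset.replicate (n - k) 1, ?_, ?_⟩, rfl⟩
      · intro i hi
        rw [Multiset.mem_cons] at hi
        obtain rfl | hi := hi
        · omega
        · rw [Multiset.eq_of_mem_replicate hi]
          exact one_pos
      · simp [hk.2]
    obtain ⟨p, hp⟩ := hp
    obtain ⟨h1, h2⟩ := isProperHook_of_parts_eq hk.1 hk.2 hp
    refine ⟨p, mem_filter.2 ⟨mem_univ _, h2⟩, ?_⟩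
    simp only [h1]
    omega
  · intro p hp
    rw [mem_filter] at hp
    have h1 := hp.2.two_le
    have h2 : (p.parts.map (starEval x)).prod =
        starEval x (n - partMult p 1) * (∑ i, x i) ^ partMult p 1 := by
      conv_lhs => rw [hp.2.1]
      simp [starEval]
    rw [h2, show n - (n - partMult p 1) = partMult p 1 by omega]
    simp only [Algebra.smul_def, map_mul, map_pow, map_neg, map_one, map_natCast]

theorem IsProperHook.logCoeff_eq {n : ℕ} (hn : 3 ≤ n) {p : n.Partition} (hp : IsProperHook p) :
    logCoeff p = (-1 : ℚ) ^ partMult p 1 * (n * ((n - 2).choose (partMult p 1) : ℚ)) := by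
  have h1 := hp.two_le
  have hl : partLength p = partMult p 1 + 1 := by
    conv_lhs => rw [partLength, hp.1]
    simp
  have hs := partLength_eq_add_sum (by omega) p
  have hs1 : ∑ i ∈ Icc 2 n, partMult p i = 1 := by omega
  have hmul : Nat.multinomial (Icc 2 n) (partMult p) = 1 := by
    rw [Nat.multinomial, hs1, prod_eq_one, Nat.factorial_one, Nat.div_one]
    intro i hi
    have : partMult p i ≤ 1 := hs1 ▸ single_le_sum (fun _ _ => Nat.zero_le _) hi
    exact Nat.factorial_eq_one.2 this
  rw [logCoeff, hmul, hl, show n - (partMult p 1 + 1) + partMult p 1 - 1 = n - 2 by omega]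
  push_cast
  rw [add_sub_cancel_left]
  ring

theorem choose_pred_eq_choose_add_choosePred {n : ℕ} (hn : 2 ≤ n) (j : ℕ) :
    (n - 1).choose j = (n - 2).choose j + choosePred (n - 2) j := by
  obtain ⟨a, rfl⟩ := Nat.exists_eq_add_of_le' hn
  cases j with
  | zero => simp [choosePred]
  | succ j => simp [choosePred, Nat.choose_succ_succ, add_comm]

/-- The coefficients of the star expansion of the chromatic symmetric function of a cycle. -/
def cycleCoeff {n : ℕ} (p : n.Partition) : ℚ :=
  if IsProperHook p then
    (-1 : ℚ) ^ partMult p 1 *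
      (-(choosePred (n - 2) (partMult p 1) : ℚ)
        + ((n : ℚ) - 1) * ((n - 2).choose (partMult p 1) : ℚ))
  else if p.parts = Multiset.replicate n 1 then 0
  else logCoeff p

theorem cycleCoeff_eq {n : ℕ} (hn : 3 ≤ n) (p : n.Partition) :
    cycleCoeff p = logCoeff p -
      if IsProperHook p then (-1 : ℚ) ^ partMult p 1 * ((n - 1).choose (partMult p 1) : ℚ)
      else 0 := by
  rw [cycleCoeff]
  split_ifs with h1 h2
  · rw [h1.logCoeff_eq hn, choose_pred_eq_choose_add_choosePred (by omega)]
    push_cast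
    ring
  · have h3 : partLength p = partMult p 1 := by
      rw [partLength, partMult, h2, Multiset.count_replicate_self, Multiset.card_replicate]
    rw [logCoeff, h3, sub_self, div_zero]
    ring
  · rw [sub_zero]

theorem chromaticEval_cycleGraph_eq_sum [Algebra ℚ R] (x : ι → R) {n : ℕ} (hn : 3 ≤ n) :
    chromaticEval (SimpleGraph.cycleGraph n) x =
      ∑ p : n.Partition, cycleCoeff p • (p.parts.map (starEval x)).prod := by
  classical
  have h1 : chromaticEval (SimpleGraph.cycleGraph n) x = coeff n (traceSeries (offDiagonal x)) := by
    obtain ⟨m, rfl⟩ := Nat.exists_eq_add_of_le' (le_trans (by norm_num : 2 ≤ 3) hn)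
    rw [chromaticEval_cycleGraph, traceSeries, coeff_mk]
  have h2 := coeff_of_one_sub_mul_eq_eulerOperator (X_dvd_scaledStarSeries x)
    (one_sub_scaledStarSeries_mul x) n
  have h3 : coeff n (Fintype.card ι : R⟦X⟧) = 0 := by
    rw [← map_natCast (C (R := R)), coeff_C, if_neg (by omega)]
  rw [sum_coeff_scaledStarSeries_pow x (by omega), map_add, map_sub, h3, sub_zero,
    coeff_starSeries_eq_sum_partition x (by omega)] at h2
  rw [h1, eq_sub_of_add_eq h2, ← sum_sub_distrib]
  exact sum_congr rfl fun p _ => by rw [cycleCoeff_eq hn, sub_smul]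

end Partitions

theorem chromaticSymmetricFunction_cycleGraph {n : ℕ} (hn : 3 ≤ n) :
    chromaticSymmetricFunction (SimpleGraph.cycleGraph n) =
      ∑ p : n.Partition, cycleCoeff p • starBasis p := by
  refine eq_of_forall_killCompl_eq fun N => ?_
  rw [killCompl_chromaticSymmetricFunction, chromaticEval_cycleGraph_eq_sum _ hn,
    ← MvPolynomial.coeToMvPowerSeries.ringHom_apply, map_sum, map_sum]
  refine Finset.sum_congr rfl fun p _ => ?_
  rw [MvPolynomial.coeToMvPowerSeries.ringHom_apply, MvPolynomial.coe_smul, map_smul,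
    killCompl_starBasis]

theorem mainTheorem8 (n : ℕ) (hn : 3 ≤ n) (c : n.Partition → ℚ) :
    chromaticSymmetricFunction (SimpleGraph.cycleGraph n) = ∑ p : n.Partition, c p • starBasis p ↔
      ∀ p : n.Partition, c p =
        if IsProperHook p then
          (-1 : ℚ) ^ partMult p 1 *
            (-(choosePred (n - 2) (partMult p 1) : ℚ)
              + ((n : ℚ) - 1) * ((n - 2).choose (partMult p 1) : ℚ))
        else if p.parts = Multiset.replicate n 1 then 0
        else
          (-1 : ℚ) ^ partMult p 1 *
            ((n : ℚ) / ((partLength p : ℚ) - (partMult p 1 : ℚ))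
              * (Nat.multinomial (Finset.Icc 2 n) (partMult p) : ℚ)
              * ((n - partLength p + partMult p 1 - 1).choose (partMult p 1) : ℚ)) := by
  change _ ↔ ∀ p : n.Partition, c p = cycleCoeff p
  rw [chromaticSymmetricFunction_cycleGraph hn]
  constructor
  · intro h p
    have h0 : ∑ p : n.Partition, (c p - cycleCoeff p) • starBasis p = 0 := by
      simp only [sub_smul]
      rw [Finset.sum_sub_distrib, h, sub_self]
    exact sub_eq_zero.1 (Fintype.linearIndependent_iff.1 (linearIndependent_starBasis n) _ h0 p)
  · intro h
    exact Finset.sum_congr rfl fun p _ => by rw [h p]
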